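/- Let $G=(V,E)$ be a finite undirected graph with $n$ vertices and edge capacities $c_G: E\to\mathbb{R}_{\ge 0}$ (a network), let $t$ be the treewidth of $G$, and let $K\subseteq V$ be a set of $k$ terminals. For an arbitrary finite network $N$ whose vertex set $V_N$ contains $K$ and for $U\subseteq K$, put $$h_K^N(U)=\min_{A\subseteq V_N,\ A\cap K=U}\ \sum_{e\in\delta_N(A)}c_N(e),$$ where $\delta_N(A)$ is the set of edges of $N$ with exactly one end in $A$. A mimicking network for $(G,K)$ is a finite undirected network $H$ with nonnegative edge capacities whose vertex set $V_H$ contains (a copy of) $K$ and such that $h_K^H(U)=h_K^G(U)$ for every $U\subseteq K$. Then $G$ has a mimicking network $H$ with at most $$k\cdot 2^{\binom{3(t+1)}{\lfloor 3(t+1)/2\rfloor}}$$ vertices. (For the graph without vertices, $t$ is read as $0$.) -/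

import Mathlib

open scoped NNReal

/-- A tree decomposition of the graph `G`, with decomposition tree on the vertex set `ι`.
Nonemptiness of the subtree attached to each vertex (part of `Connected`) says that every vertex
lies in some bag. -/
structure TreeDecomposition {V : Type*} (G : SimpleGraph V) (ι : Type*) where
  /-- The decomposition tree. -/
  tree : SimpleGraph ι
  isTree : tree.IsTree
  /-- The bag at each node of the tree. -/
  bag : ι → Finset V
  exists_bag_of_adj : ∀ u v : V, G.Adj u v → ∃ i, u ∈ bag i ∧ v ∈ bag i
  connected_bags : ∀ v : V, (tree.induce {i | v ∈ bag i}).Connected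

/-- `G` has a finite tree decomposition of width at most `w`, i.e. with all bags of
size at most `w + 1`. -/
def HasTreewidthAtMost {V : Type*} (G : SimpleGraph V) (w : ℕ) : Prop :=
  ∃ (m : ℕ) (D : TreeDecomposition G (Fin m)), ∀ i, (D.bag i).card ≤ w + 1

/-- The treewidth of a (finite) graph. -/
noncomputable def treewidth {V : Type*} (G : SimpleGraph V) : ℕ :=
  sInf {w | HasTreewidthAtMost G w}

/-- A finite graph has some tree decomposition, so `treewidth` is a genuine minimum. -/
theorem hasTreewidthAtMost_treewidth {V : Type*} [Fintype V] (G : SimpleGraph V) :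
    HasTreewidthAtMost G (treewidth G) := by
  refine Nat.sInf_mem (s := {w | HasTreewidthAtMost G w}) ⟨Fintype.card V, 1, ?_⟩
  refine ⟨⟨⊥, SimpleGraph.IsTree.of_subsingleton, fun _ => Finset.univ,
    fun _ _ _ => ⟨0, by simp, by simp⟩, fun v => ?_⟩, fun i => by simp⟩
  have : Nonempty {i : Fin 1 | v ∈ (Finset.univ : Finset V)} := ⟨⟨0, by simp⟩⟩
  exact SimpleGraph.IsTree.of_subsingleton.1

/-- An undirected graph with nonnegative edge capacities. Only the values of `cap` on the edges
of `graph` are ever used. -/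
structure CapacitatedNetwork (V : Type*) where
  /-- The underlying graph. -/
  graph : SimpleGraph V
  /-- The edge capacities. -/
  cap : Sym2 V → ℝ≥0

namespace CapacitatedNetwork

open Classical in
/-- The set `δ(A)` of edges with one end in `A` and the other end outside `A`. -/
noncomputable def crossingEdges {V : Type*} [Fintype V] (G : CapacitatedNetwork V)
    (A : Finset V) : Finset (Sym2 V) :=
  {e | e ∈ G.graph.edgeSet ∧ ∃ u v : V, u ∈ A ∧ v ∉ A ∧ e = s(u, v)}

/-- The cut function: the total capacity of the edges in `δ(A)`. -/
noncomputable def cutValue {V : Type*} [Fintype V] (G : CapacitatedNetwork V)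
    (A : Finset V) : ℝ≥0 :=
  ∑ e ∈ G.crossingEdges A, G.cap e

open Classical in
/-- The vertex sets `A` whose intersection with the terminals is exactly `U`. The terminals
`T` sit in the vertex set through the injection `τ`. -/
noncomputable def separatingSets {V T : Type*} [Fintype V] (τ : T ↪ V) (U : Finset T) :
    Finset (Finset V) :=
  {A | ∀ x : T, τ x ∈ A ↔ x ∈ U}

theorem separatingSets_nonempty {V T : Type*} [Fintype V] (τ : T ↪ V) (U : Finset T) :
    (separatingSets τ U).Nonempty :=
  ⟨U.map τ, by simp [separatingSets]⟩

/-- The terminal cut function: the minimum of the cut function over all vertex sets whose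
intersection with the terminals is `U`, i.e. the value of a minimum cut separating `U` from the
other terminals. -/
noncomputable def terminalCut {V T : Type*} [Fintype V] (G : CapacitatedNetwork V) (τ : T ↪ V)
    (U : Finset T) : ℝ≥0 :=
  (separatingSets τ U).inf' (separatingSets_nonempty τ U) G.cutValue

/-- `H`, whose vertex set contains the terminal set `K` of `G` through the injection `σ`, is a
mimicking network for `G` and `K`: every terminal cut has the same value in `G` and in `H`. -/
def IsMimickingNetwork {V W : Type*} [Fintype V] [Fintype W] (G : CapacitatedNetwork V)
    (K : Finset V) (H : CapacitatedNetwork W) (σ : K ↪ W) : Prop :=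
  ∀ U : Finset K, H.terminalCut σ U = G.terminalCut (Function.Embedding.subtype (· ∈ K)) U

end CapacitatedNetwork

/-! ### Cut functions -/

/-! Let `s = t + 1` and `P = 2 ^ 2 ^ (2 * s)`. Fix a minimum cut for each subset of a set of at most
`2 * s` terminals and identify vertices lying on the same sides of all of them. This leaves at most
`P` vertices and preserves all terminal cuts (`IsCutFunction.represents`). Networks sharing only
terminals can be replaced separately and reglued (`Represents.add`).

A rooted tree decomposition is processed from the deepest nodes upwards. Contracting at every node
would cost `P` per node, so the part below a bag is kept as `p + q`. Here `q` is already compressed,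
while the uncompressed `p` absorbs everything that brings no new terminal and has all its terminals
in two sets of size at most `s`. Compression happens only when a terminal leaves the bag or two
parts with terminals below the bag merge. With `j > 0` terminals below the bag, `q` costs at most
`(3j - 2)P`, hence the whole part at most `(3j - 1)P`; two such parts together cost `(3j + 3j' -
2)P`, so the invariant survives.

The total is at most `3kP`, which is below the stated bound when `t > 0` by
`four_pow_add_four_le_choose`. For `t = 0` all cuts vanish. -/

/-- The unordered pair `z` has exactly one end in `A`. -/
def Crosses {V : Type*} (z : Sym2 V) (A : Set V) : Prop :=
  ∃ u v : V, u ∈ A ∧ v ∉ A ∧ z = s(u, v)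

theorem crosses_mk {V : Type*} (a b : V) (A : Set V) :
    Crosses s(a, b) A ↔ (a ∈ A ∧ b ∉ A) ∨ (b ∈ A ∧ a ∉ A) := by
  constructor
  · rintro ⟨u, v, hu, hv, h⟩
    rcases Sym2.eq_iff.1 h with ⟨rfl, rfl⟩ | ⟨rfl, rfl⟩
    · exact Or.inl ⟨hu, hv⟩
    · exact Or.inr ⟨hu, hv⟩
  · rintro (⟨ha, hb⟩ | ⟨hb, ha⟩)
    · exact ⟨a, b, ha, hb, rfl⟩
    · exact ⟨b, a, hb, ha, Sym2.eq_swap⟩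

theorem crosses_map {V W : Type*} (φ : V → W) (z : Sym2 V) (A : Set W) :
    Crosses (z.map φ) A ↔ Crosses z (φ ⁻¹' A) := by
  induction z with
  | _ a b => simp [crosses_mk]

open Classical in
/-- `f` is the cut function of a system of nonnegative capacities. -/
def IsCutFunction {V : Type*} [Fintype V] (f : Set V → ℝ≥0) : Prop :=
  ∃ c : Sym2 V → ℝ≥0, ∀ A, f A = ∑ z, if Crosses z A then c z else 0

theorem IsCutFunction.zero {V : Type*} [Fintype V] : IsCutFunction (0 : Set V → ℝ≥0) :=
  ⟨0, by simp⟩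

theorem IsCutFunction.add {V : Type*} [Fintype V] {f g : Set V → ℝ≥0}
    (hf : IsCutFunction f) (hg : IsCutFunction g) : IsCutFunction (f + g) := by
  obtain ⟨c, hc⟩ := hf
  obtain ⟨d, hd⟩ := hg
  refine ⟨c + d, fun A => ?_⟩
  rw [Pi.add_apply, hc, hd, ← Finset.sum_add_distrib]
  refine Finset.sum_congr rfl fun z _ => ?_
  split_ifs <;> simp

/-- Identifying vertices along `φ` adds up the capacities of parallel pairs; pairs that become loops
never cross a cut. -/
theorem IsCutFunction.comp_preimage {V W : Type*} [Fintype V] [Fintype W] {f : Set V → ℝ≥0}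
    (hf : IsCutFunction f) (φ : V → W) : IsCutFunction fun A => f (φ ⁻¹' A) := by
  classical
  obtain ⟨c, hc⟩ := hf
  refine ⟨fun z' => ∑ z with z.map φ = z', c z, fun A => ?_⟩
  dsimp only
  rw [hc, ← Finset.sum_fiberwise Finset.univ (Sym2.map φ)]
  refine Finset.sum_congr rfl fun z' _ => ?_
  split_ifs with h
  · refine Finset.sum_congr rfl fun z hz => ?_
    rw [if_pos]
    rw [← crosses_map, (Finset.mem_filter.1 hz).2]
    exact h
  · refine Finset.sum_eq_zero fun z hz => ?_
    rw [if_neg]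
    rw [← crosses_map, (Finset.mem_filter.1 hz).2]
    exact h

/-- `f A` only depends on `A ∩ X`. -/
def IsLocal {V : Type*} (f : Set V → ℝ≥0) (X : Finset V) : Prop :=
  ∀ A A' : Set V, (∀ v ∈ X, v ∈ A ↔ v ∈ A') → f A = f A'

theorem IsLocal.mono {V : Type*} {f : Set V → ℝ≥0} {X Y : Finset V} (hf : IsLocal f X)
    (h : X ⊆ Y) : IsLocal f Y :=
  fun A A' hA => hf A A' fun v hv => hA v (h hv)

theorem IsLocal.zero {V : Type*} (X : Finset V) : IsLocal (0 : Set V → ℝ≥0) X :=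
  fun _ _ _ => rfl

theorem IsLocal.add {V : Type*} [DecidableEq V] {f g : Set V → ℝ≥0} {X Y : Finset V}
    (hf : IsLocal f X) (hg : IsLocal g Y) : IsLocal (f + g) (X ∪ Y) := by
  intro A A' h
  rw [Pi.add_apply, Pi.add_apply, hf A A' fun v hv => h v (Finset.mem_union_left _ hv),
    hg A A' fun v hv => h v (Finset.mem_union_right _ hv)]

/-! ### Small networks with the same terminal cuts -/

/-- There is a network with at most `m` vertices, among them a copy of `S`, in which the minimum
cuts separating parts of `S` have the same values as for `f`. -/
def Represents.{u} {V : Type u} (f : Set V → ℝ≥0) (S : Finset V) (m : ℕ) : Prop :=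
  ∃ (W : Type u) (_ : Fintype W) (g : Set W → ℝ≥0) (σ : V → W),
    Fintype.card W ≤ m ∧ IsCutFunction g ∧
    (∀ A : Set V, ∃ A' : Set W, (∀ v ∈ S, σ v ∈ A' ↔ v ∈ A) ∧ g A' ≤ f A) ∧
    (∀ A' : Set W, ∃ A : Set V, (∀ v ∈ S, σ v ∈ A' ↔ v ∈ A) ∧ f A ≤ g A')

theorem Represents.mono {V : Type*} {f : Set V → ℝ≥0} {S S' : Finset V} {m m' : ℕ}
    (h : Represents f S m) (hS : S' ⊆ S) (hm : m ≤ m') : Represents f S' m' := by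
  obtain ⟨W, _, g, σ, hW, hg, h₁, h₂⟩ := h
  refine ⟨W, _, g, σ, hW.trans hm, hg, fun A => ?_, fun A' => ?_⟩
  · obtain ⟨A', hA, hle⟩ := h₁ A
    exact ⟨A', fun v hv => hA v (hS hv), hle⟩
  · obtain ⟨A, hA, hle⟩ := h₂ A'
    exact ⟨A, fun v hv => hA v (hS hv), hle⟩

/-- Vertices which lie on the same sides of all chosen minimum cuts can be identified. -/
theorem IsCutFunction.represents {V : Type*} [Fintype V] {f : Set V → ℝ≥0}
    (hf : IsCutFunction f) (S : Finset V) : Represents f S (2 ^ 2 ^ S.card) := by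
  classical
  have hmin : ∀ U : Finset S, ∃ A : Set V, (∀ v : S, v.1 ∈ A ↔ v ∈ U) ∧
      ∀ B : Set V, (∀ v : S, v.1 ∈ B ↔ v ∈ U) → f A ≤ f B := by
    intro U
    obtain ⟨A, hA, hmin⟩ := Set.exists_min_image {A : Set V | ∀ v : S, v.1 ∈ A ↔ v ∈ U} f
      (Set.toFinite _) ⟨{v | ∃ h : v ∈ S, ⟨v, h⟩ ∈ U}, fun v => by simp⟩
    exact ⟨A, hA, hmin⟩
  choose M hM hMmin using hmin
  -- A vertex is sent to its sides of the chosen cuts, so each `M U` is a union of fibres and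
  -- survives the contraction.
  let π : V → Finset (Finset S) := fun v => {U | v ∈ M U}
  refine ⟨Finset (Finset S), inferInstance, fun A => f (π ⁻¹' A), π, by simp,
    hf.comp_preimage π, fun A => ?_, fun A' => ⟨π ⁻¹' A', fun v _ => Iff.rfl, le_rfl⟩⟩
  let U : Finset S := {v | v.1 ∈ A}
  have hπ : π ⁻¹' {F | U ∈ F} = M U := by
    ext v
    simp [π]
  refine ⟨{F | U ∈ F}, fun v hv => ?_, ?_⟩
  · have := hM U ⟨v, hv⟩
    simpa [π, U] using this
  · change f (π ⁻¹' {F | U ∈ F}) ≤ f A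
    rw [hπ]
    exact hMmin U A fun v => by simp [U]

/-- Gluing two networks along common terminals. -/
theorem Represents.add {V : Type*} [DecidableEq V] {p q : Set V → ℝ≥0} {X Y S T : Finset V}
    {m n : ℕ} (hp : Represents p S m) (hq : Represents q T n) (hpX : IsLocal p X)
    (hqY : IsLocal q Y) (hSX : S ⊆ X) (hTY : T ⊆ Y) (hXY : X ∩ Y ⊆ S ∩ T) :
    Represents (p + q) (S ∪ T) (m + n) := by
  classical
  obtain ⟨W₁, _, g₁, σ₁, hW₁, hg₁, hp₁, hp₂⟩ := hp
  obtain ⟨W₂, _, g₂, σ₂, hW₂, hg₂, hq₁, hq₂⟩ := hq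
  -- Distinct terminals have distinct copies because the cut `{u}` has a counterpart separating
  -- them.
  have hinj : ∀ u ∈ T, ∀ v ∈ T, σ₂ u = σ₂ v → u = v := by
    intro u hu v hv h
    obtain ⟨A', hA', -⟩ := hq₁ {u}
    have h₁ := hA' u hu
    have h₂ := hA' v hv
    rw [← h] at h₂
    exact ((h₂.1 (h₁.2 rfl)) : v = u).symm
  -- The copy in `W₂` of a common terminal is redirected to its copy in `W₁`; its old place stays as
  -- an isolated vertex.
  let φ : W₂ → W₁ ⊕ W₂ := fun w =>
    if h : ∃ v, v ∈ S ∧ v ∈ T ∧ σ₂ v = w then Sum.inl (σ₁ h.choose) else Sum.inr w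
  let σ : V → W₁ ⊕ W₂ := fun v => if v ∈ S then Sum.inl (σ₁ v) else Sum.inr (σ₂ v)
  have hσS : ∀ v ∈ S, σ v = Sum.inl (σ₁ v) := fun v hv => if_pos hv
  have hφ : ∀ v ∈ T, φ (σ₂ v) = σ v := by
    intro v hv
    by_cases hS : v ∈ S
    · have h : ∃ u, u ∈ S ∧ u ∈ T ∧ σ₂ u = σ₂ v := ⟨v, hS, hv, rfl⟩
      have hc : h.choose = v := hinj _ h.choose_spec.2.1 _ hv h.choose_spec.2.2
      rw [hσS v hS]
      change (if h : ∃ u, u ∈ S ∧ u ∈ T ∧ σ₂ u = σ₂ v then _ else _) = _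
      rw [dif_pos h, hc]
    · have h : ¬ ∃ u, u ∈ S ∧ u ∈ T ∧ σ₂ u = σ₂ v := by
        rintro ⟨u, huS, huT, hu⟩
        exact hS (hinj _ huT _ hv hu ▸ huS)
      change (if h : ∃ u, u ∈ S ∧ u ∈ T ∧ σ₂ u = σ₂ v then _ else _) = _
      rw [dif_neg h]
      exact (if_neg hS).symm
  refine ⟨W₁ ⊕ W₂, inferInstance, fun A => g₁ (Sum.inl ⁻¹' A) + g₂ (φ ⁻¹' A), σ,
    by rw [Fintype.card_sum]; omega,
    (hg₁.comp_preimage Sum.inl).add (hg₂.comp_preimage φ), fun A => ?_, fun A' => ?_⟩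
  · obtain ⟨A₁, hA₁, hle₁⟩ := hp₁ A
    obtain ⟨A₂, hA₂, hle₂⟩ := hq₁ A
    have h₂ : φ ⁻¹' (Sum.inl '' A₁ ∪ Sum.inr '' A₂) = A₂ := by
      ext w
      by_cases h : ∃ v, v ∈ S ∧ v ∈ T ∧ σ₂ v = w
      · obtain ⟨v, hS, hT, rfl⟩ := h
        simp [hφ v hT, hσS v hS, hA₁ v hS, hA₂ v hT]
      · have : φ w = Sum.inr w := dif_neg h
        simp [this]
    refine ⟨Sum.inl '' A₁ ∪ Sum.inr '' A₂, fun v hv => ?_, ?_⟩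
    · by_cases hS : v ∈ S
      · simp [hσS v hS, hA₁ v hS]
      · have hT : v ∈ T := (Finset.mem_union.1 hv).resolve_left hS
        rw [← hφ v hT, ← Set.mem_preimage, h₂, hA₂ v hT]
    · have h₁ : Sum.inl ⁻¹' (Sum.inl '' A₁ ∪ Sum.inr '' A₂) = A₁ := by
        ext w
        simp
      dsimp only
      rw [h₁, h₂]
      exact add_le_add hle₁ hle₂
  · obtain ⟨A₁, hA₁, hle₁⟩ := hp₂ (Sum.inl ⁻¹' A')
    obtain ⟨A₂, hA₂, hle₂⟩ := hq₂ (φ ⁻¹' A')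
    have hS : ∀ v ∈ S, σ v ∈ A' ↔ v ∈ A₁ := fun v hv => by
      rw [← hA₁ v hv, hσS v hv, Set.mem_preimage]
    have hT : ∀ v ∈ T, σ v ∈ A' ↔ v ∈ A₂ := fun v hv => by
      rw [← hA₂ v hv, ← hφ v hv, Set.mem_preimage]
    -- The two cuts agree wherever `p` and `q` overlap, since all overlap consists of terminals; so
    -- they combine into one cut.
    have hXY' : ∀ v ∈ X, v ∈ Y → (v ∈ A₁ ↔ v ∈ A₂) := fun v hX hY => by
      have := Finset.mem_inter.1 (hXY (Finset.mem_inter.2 ⟨hX, hY⟩))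
      rw [← hS v this.1, ← hT v this.2]
    have hY : ∀ v ∈ Y, v ∈ {v | if v ∈ X then v ∈ A₁ else v ∈ A₂} ↔ v ∈ A₂ := by
      intro v hv
      by_cases hX : v ∈ X
      · simp [hX, hXY' v hX hv]
      · simp [hX]
    have hX : ∀ v ∈ X, v ∈ {v | if v ∈ X then v ∈ A₁ else v ∈ A₂} ↔ v ∈ A₁ := by
      intro v hv
      simp [hv]
    refine ⟨{v | if v ∈ X then v ∈ A₁ else v ∈ A₂}, fun v hv => ?_, ?_⟩
    · rcases Finset.mem_union.1 hv with h | h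
      · rw [hX v (hSX h), hS v h]
      · rw [hY v (hTY h), hT v h]
    · rw [Pi.add_apply, hpX _ A₁ hX, hqY _ A₂ hY]
      exact add_le_add hle₁ hle₂

theorem Represents.zero {V : Type*} {S : Finset V} (hS : S.Nonempty) :
    Represents (0 : Set V → ℝ≥0) S S.card := by
  classical
  obtain ⟨s, hs⟩ := hS
  refine ⟨S, inferInstance, 0, fun v => if h : v ∈ S then ⟨v, h⟩ else ⟨s, hs⟩, by simp,
    IsCutFunction.zero, fun A => ⟨{v | v.1 ∈ A}, fun v hv => by simp [hv], le_rfl⟩,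
    fun A' => ⟨{v | ∃ h : v ∈ S, ⟨v, h⟩ ∈ A'}, fun v hv => by simp [hv], le_rfl⟩⟩

/-! ### From cut functions back to networks -/

namespace CapacitatedNetwork

theorem cutValue_eq_sum {V : Type*} [Fintype V] (H : CapacitatedNetwork V)
    (A : Finset V) [DecidablePred fun z : Sym2 V => z ∈ H.graph.edgeSet ∧ Crosses z (A : Set V)] :
    H.cutValue A = ∑ z, if z ∈ H.graph.edgeSet ∧ Crosses z (A : Set V) then H.cap z else 0 := by
  classical
  rw [cutValue, crossingEdges, Finset.sum_filter]
  refine Finset.sum_congr rfl fun z _ => ?_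
  simp [Crosses]

theorem exists_isMimickingNetwork {V : Type*} [Fintype V] (G : CapacitatedNetwork V)
    (K : Finset V) {F : Set V → ℝ≥0} (hF : ∀ A : Finset V, G.cutValue A = F A) {m : ℕ}
    (h : Represents F K m) :
    ∃ (m' : ℕ) (H : CapacitatedNetwork (Fin m')) (σ : K ↪ Fin m'),
      G.IsMimickingNetwork K H σ ∧ m' ≤ m := by
  classical
  obtain ⟨W, _, g, σ, hW, hg, h₁, h₂⟩ := h
  let e := Fintype.equivFin W
  obtain ⟨c, hc⟩ := hg.comp_preimage e
  have hinj : Function.Injective fun v : K => e (σ v) := by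
    intro u v huv
    have huv : σ u = σ v := e.injective huv
    obtain ⟨A', hA', -⟩ := h₁ {u.1}
    have hu := hA' u u.2
    have hv := hA' v v.2
    rw [← huv] at hv
    exact Subtype.ext ((hv.1 (hu.2 rfl)) : v.1 = u.1).symm
  -- The complete graph suffices: a crossing pair is never a loop, and capacities may be zero.
  let H : CapacitatedNetwork (Fin (Fintype.card W)) := ⟨⊤, c⟩
  have hH : ∀ A : Finset (Fin (Fintype.card W)), H.cutValue A = g (e ⁻¹' (A : Set _)) := by
    intro A
    rw [cutValue_eq_sum]
    refine (Finset.sum_congr rfl fun z _ => ?_).trans (hc A).symm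
    have hedge : Crosses z (A : Set _) → z ∈ H.graph.edgeSet := by
      rintro ⟨u, v, hu, hv, rfl⟩
      change u ≠ v
      rintro rfl
      exact hv hu
    exact if_congr ⟨fun h => h.2, fun h => ⟨hedge h, h⟩⟩ rfl rfl
  refine ⟨_, H, ⟨_, hinj⟩, fun U => le_antisymm ?_ ?_, hW⟩
  · refine Finset.le_inf' _ _ fun A hA => ?_
    obtain ⟨A', hA', hle⟩ := h₁ A
    rw [hF]
    refine le_trans ?_ hle
    have hmem : ({w | e.symm w ∈ A'} : Finset _) ∈ separatingSets ⟨_, hinj⟩ U := by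
      simp only [separatingSets, Finset.mem_filter, Finset.mem_univ, true_and] at hA ⊢
      intro x
      rw [← hA x]
      simp [hA' x x.2]
    refine (Finset.inf'_le _ hmem).trans (le_of_eq ?_)
    rw [hH]
    congr 1
    ext w
    simp
  · refine Finset.le_inf' _ _ fun A hA => ?_
    obtain ⟨A', hA', hle⟩ := h₂ (e ⁻¹' (A : Set _))
    rw [hH]
    refine le_trans ?_ hle
    have hmem : ({w | w ∈ A'} : Finset _) ∈
        separatingSets (Function.Embedding.subtype (· ∈ K)) U := by
      simp only [separatingSets, Finset.mem_filter, Finset.mem_univ, true_and] at hA ⊢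
      intro x
      rw [← hA x]
      simpa using (hA' x x.2).symm
    refine (Finset.inf'_le _ hmem).trans (le_of_eq ?_)
    rw [hF]
    congr 1
    ext w
    simp

end CapacitatedNetwork

/-! ### Tree decompositions -/

/-- `d` is the distance to the root and `p i` the next node towards it. If `j` is no deeper than
`i`, the tree path from `i` to `j` starts through `p i`; by uniqueness of paths it is also the path
inside the subtree of any vertex common to both bags. -/
theorem TreeDecomposition.exists_parent {V ι : Type*} {G : SimpleGraph V}
    (D : TreeDecomposition G ι) (r : ι) :
    ∃ (d : ι → ℕ) (p : ι → ι), (∀ i, d r ≤ d i) ∧ ∀ i, i ≠ r → d (p i) < d i ∧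
      ∀ j, j ≠ i → d j ≤ d i → ∀ v, v ∈ D.bag i → v ∈ D.bag j → v ∈ D.bag (p i) := by
  classical
  have hconn := D.isTree.connected
  have hpar : ∀ i, ∃ p, i ≠ r → D.tree.Adj i p ∧ D.tree.dist p r < D.tree.dist i r := by
    intro i
    obtain ⟨w, hw⟩ := hconn.exists_walk_length_eq_dist i r
    cases w with
    | nil => exact ⟨r, fun h => (h rfl).elim⟩
    | cons h w =>
      refine ⟨_, fun _ => ⟨h, ?_⟩⟩
      have := SimpleGraph.dist_le w
      rw [SimpleGraph.Walk.length_cons] at hw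
      omega
  choose p hp using hpar
  refine ⟨fun i => D.tree.dist i r, p, by simp, fun i hi => ⟨(hp i hi).2, fun j hji hd v hvi hvj => ?_⟩⟩
  obtain ⟨hadj, hlt⟩ := hp i hi
  obtain ⟨w₁, hw₁⟩ := hconn.exists_walk_length_eq_dist (p i) r
  obtain ⟨w₂, hw₂⟩ := hconn.exists_walk_length_eq_dist j r
  have h₁ : i ∉ w₁.support := by
    intro h
    have := SimpleGraph.dist_le (w₁.dropUntil i h)
    have := w₁.length_dropUntil_le_length h
    omega
  have h₂ : i ∉ w₂.support := by
    intro h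
    have := SimpleGraph.dist_le (w₂.dropUntil i h)
    have hd : D.tree.dist j r ≤ D.tree.dist i r := hd
    have := w₂.length_dropUntil_lt_length h hji.symm
    omega
  let w := (w₁.append w₂.reverse).bypass
  have hw : i ∉ w.support := by
    intro h
    have h := SimpleGraph.Walk.support_bypass_subset_support _ h
    rw [SimpleGraph.Walk.mem_support_append_iff, SimpleGraph.Walk.support_reverse,
      List.mem_reverse] at h
    exact h.elim h₁ h₂
  have hpath : (SimpleGraph.Walk.cons hadj w).IsPath :=
    (SimpleGraph.Walk.cons_isPath_iff _ _).2 ⟨SimpleGraph.Walk.bypass_isPath _, hw⟩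
  obtain ⟨q⟩ := (D.connected_bags v).preconnected ⟨i, hvi⟩ ⟨j, hvj⟩
  let f := (SimpleGraph.Embedding.induce (G := D.tree) {i | v ∈ D.bag i}).toHom
  have hqpath : (q.bypass.map f).IsPath :=
    q.bypass_isPath.map Subtype.val_injective
  have heq := congrArg Subtype.val
    ((D.isTree.isAcyclic.subsingleton_path i j).elim ⟨_, hpath⟩ ⟨_, hqpath⟩)
  have hmem : p i ∈ (q.bypass.map f).support := by
    have heq : SimpleGraph.Walk.cons hadj w = q.bypass.map f := heq
    have hsupp : (SimpleGraph.Walk.cons hadj w).support = (q.bypass.map f).support :=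
      congrArg SimpleGraph.Walk.support heq
    rw [← hsupp, SimpleGraph.Walk.support_cons]
    exact List.mem_cons_of_mem _ w.start_mem_support
  rw [SimpleGraph.Walk.support_map, List.mem_map] at hmem
  obtain ⟨x, -, hx⟩ := hmem
  rw [← hx]
  exact x.2

/-! ### The numerical estimate -/

/-- The middle binomial coefficient is at least the average `8 ^ s / (3 * s + 1)`. The summand `4`
pays for the factor `3` in `3kP`. The case `s = 2` is an equality and `s = 1` fails. -/
theorem four_pow_add_four_le_choose {s : ℕ} (hs : 2 ≤ s) :
    4 ^ s + 4 ≤ (3 * s).choose (3 * s / 2) := by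
  rcases (by omega : s = 2 ∨ s = 3 ∨ 4 ≤ s) with rfl | rfl | h
  · decide
  · decide
  have hsum : 8 ^ s ≤ (3 * s + 1) * (3 * s).choose (3 * s / 2) := by
    have h := Finset.sum_le_card_nsmul (Finset.range (3 * s + 1)) (fun i => (3 * s).choose i)
      ((3 * s).choose (3 * s / 2)) fun i _ => Nat.choose_le_middle i _
    rw [Nat.sum_range_choose, Finset.card_range, smul_eq_mul, pow_mul] at h
    exact h
  have h₂ : 3 * s + 4 ≤ 2 ^ s := by
    clear hsum hs
    induction s, h using Nat.le_induction with
    | base => norm_num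
    | succ n hn ih => rw [pow_succ]; omega
  have h₄ : 4 * (3 * s + 1) ≤ 3 * 4 ^ s := by
    have : 2 ^ s ≤ 4 ^ s := Nat.pow_le_pow_left (by norm_num) s
    have : 16 * 2 ^ s ≤ 2 ^ s * 2 ^ s :=
      Nat.mul_le_mul_right _ (Nat.pow_le_pow_right (n := 2) (by norm_num) h)
    rw [← mul_pow] at this
    norm_num at this
    omega
  have h₈ : (8 : ℕ) ^ s = 4 ^ s * 2 ^ s := by
    rw [← mul_pow]; norm_num
  have : (3 * s + 1) * (4 ^ s + 4) ≤ 8 ^ s := by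
    have := Nat.mul_le_mul_left (4 ^ s) h₂
    rw [h₈]
    nlinarith
  exact Nat.le_of_mul_le_mul_left (this.trans hsum) (by omega)

/-! ### Dynamic programming over a tree decomposition -/

theorem not_nonempty_inter_sdiff {V : Type*} [DecidableEq V] {K X B : Finset V} :
    ¬ (K ∩ (X \ B)).Nonempty ↔ ∀ v ∈ K, v ∈ X → v ∈ B := by
  simp only [Finset.Nonempty, Finset.mem_inter, Finset.mem_sdiff]
  grind

/-- The state at a node with bag `B`, where `f` is the total cut function of the part of the
network below that node and `X` its vertex set: if there are terminals below the bag, then `f`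
splits as `p + q`, where `p` meets `B` and the vertices of `q` in small sets, and `q` is already
represented by a network whose size is linear in the number of terminals below `B`. -/
structure PartialReduction {V : Type*} [Fintype V] [DecidableEq V] (s : ℕ) (K B X : Finset V)
    (f : Set V → ℝ≥0) : Prop where
  isCut : IsCutFunction f
  isLocal : IsLocal f X
  bag_subset : B ⊆ X
  card_bag : B.card ≤ s
  split : (K ∩ (X \ B)).Nonempty → ∃ (C Y Z : Finset V) (p q : Set V → ℝ≥0) (a : ℕ),
    f = p + q ∧ IsCutFunction p ∧ IsLocal p Y ∧ IsLocal q Z ∧ Y ∪ Z = X ∧ Y ∩ Z ⊆ C ∧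
    C ⊆ Y ∧ C ⊆ Z ∧ B ⊆ Y ∧ K ∩ Y ⊆ B ∪ C ∧ C.card ≤ s ∧ Represents q (C ∪ (K ∩ Z)) a ∧
    a + 2 * 2 ^ 2 ^ (2 * s) ≤ 3 * (K ∩ (X \ B)).card * 2 ^ 2 ^ (2 * s)

namespace PartialReduction

variable {V : Type*} [Fintype V] [DecidableEq V] {s : ℕ} {K B X : Finset V} {f : Set V → ℝ≥0}

theorem of_isLocal_bag (hf : IsCutFunction f) (hB : IsLocal f B) (hs : B.card ≤ s) :
    PartialReduction s K B B f :=
  ⟨hf, hB, subset_rfl, hs, fun h => by simp at h⟩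

/-- Contracting `p` relative to `B ∪ C` costs one more `P`; the result is glued to the network for
`q` along `C`. -/
theorem represents_of_nonempty (h : PartialReduction s K B X f) (hK : (K ∩ (X \ B)).Nonempty) :
    ∃ b, Represents f (B ∪ (K ∩ X)) b ∧
      b + 2 ^ 2 ^ (2 * s) ≤ 3 * (K ∩ (X \ B)).card * 2 ^ 2 ^ (2 * s) := by
  obtain ⟨C, Y, Z, p, q, a, rfl, hp, hpY, hqZ, hYZ, hC, hCY, hCZ, hBY, hKY, hcard, hq, ha⟩ :=
    h.split hK
  have hBC : (B ∪ C).card ≤ 2 * s := by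
    have := Finset.card_union_le B C
    have := h.card_bag
    omega
  have hp' : Represents p (B ∪ C) (2 ^ 2 ^ (2 * s)) :=
    (hp.represents _).mono subset_rfl (Nat.pow_le_pow_right (by norm_num)
      (Nat.pow_le_pow_right (by norm_num) hBC))
  refine ⟨2 ^ 2 ^ (2 * s) + a, (hp'.add hq hpY hqZ (by grind) (by grind) (by grind)).mono
    (by grind) le_rfl, by omega⟩

theorem represents_of_not_nonempty (h : PartialReduction s K B X f)
    (hK : ¬ (K ∩ (X \ B)).Nonempty) : Represents f (B ∪ (K ∩ X)) (2 ^ 2 ^ (2 * s)) := by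
  rw [not_nonempty_inter_sdiff] at hK
  have hB := h.card_bag
  refine (h.isCut.represents B).mono (by grind) (Nat.pow_le_pow_right (by norm_num)
      (Nat.pow_le_pow_right (by norm_num) (by omega)))

/-- Replacing the bag at the root of a part by the bag of the parent node. -/
theorem change_bag (h : PartialReduction s K B X f) {B' : Finset V} (hB' : B'.card ≤ s)
    (hBX : B' ∩ X ⊆ B) : PartialReduction s K B' (X ∪ B') f := by
  refine ⟨h.isCut, h.isLocal.mono Finset.subset_union_left, Finset.subset_union_right, hB',
    fun hK => ?_⟩
  have hBX' := h.bag_subset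
  have hcard : (K ∩ (X \ B)).card + (K ∩ (B \ B')).card ≤ (K ∩ ((X ∪ B') \ B')).card := by
    rw [← Finset.card_union_of_disjoint (by rw [Finset.disjoint_left]; grind)]
    exact Finset.card_le_card (by grind)
  -- If a terminal leaves the bag, the count below grows, which pays for compressing all of `f` into
  -- `q`. Otherwise the old split stays valid with `B'` added to `Y`.
  by_cases hKB : (K ∩ (B \ B')).Nonempty
  · have hpos := hKB.card_pos
    obtain ⟨b, hb, hb'⟩ : ∃ b, Represents f (B ∪ (K ∩ X)) b ∧ b + 2 * 2 ^ 2 ^ (2 * s) ≤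
        3 * ((K ∩ (X \ B)).card + 1) * 2 ^ 2 ^ (2 * s) := by
      by_cases hX : (K ∩ (X \ B)).Nonempty
      · obtain ⟨b, hb, hb'⟩ := h.represents_of_nonempty hX
        refine ⟨b, hb, ?_⟩
        generalize 2 ^ 2 ^ (2 * s) = P at hb' ⊢
        linarith
      · exact ⟨_, h.represents_of_not_nonempty hX, by
          rw [Finset.not_nonempty_iff_eq_empty.1 hX, Finset.card_empty]; omega⟩
    refine ⟨B, B ∪ B', X, 0, f, b, by simp, IsCutFunction.zero, IsLocal.zero _, h.isLocal,
      by grind, by grind, by grind, by grind, by grind, by grind, h.card_bag, hb, hb'.trans ?_⟩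
    exact Nat.mul_le_mul_right _ (by omega)
  · rw [not_nonempty_inter_sdiff] at hKB
    have hX : (K ∩ (X \ B)).Nonempty := by
      by_contra hX
      rw [not_nonempty_inter_sdiff] at hX
      obtain ⟨v, hv⟩ := hK
      grind
    obtain ⟨C, Y, Z, p, q, a, hf, hp, hpY, hqZ, hYZ, hC, hCY, hCZ, hBY, hKY, hcardC, hq, ha⟩ :=
      h.split hX
    have hKY' : ∀ v ∈ K, v ∈ Y → v ∈ B ∪ C := fun v hv hv' => hKY (by simp [hv, hv'])
    refine ⟨C, Y ∪ B', Z, p, q, a, hf, hp, hpY.mono Finset.subset_union_left, hqZ,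
      by grind, by grind, by grind, hCZ, by grind, by grind, hcardC, hq, ha.trans ?_⟩
    exact Nat.mul_le_mul_right _ (by omega)

/-- A part without terminals below the bag is added to `p` uncompressed, hence at no cost. -/
theorem add_aux (h : PartialReduction s K B X f) {X' : Finset V} {f' : Set V → ℝ≥0}
    (h' : PartialReduction s K B X' f') (hX : X ∩ X' ⊆ B)
    (hX' : ¬ (K ∩ (X' \ B)).Nonempty) : PartialReduction s K B (X ∪ X') (f + f') := by
  refine ⟨h.isCut.add h'.isCut, h.isLocal.add h'.isLocal,
    h.bag_subset.trans Finset.subset_union_left, h.card_bag, fun hK => ?_⟩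
  rw [not_nonempty_inter_sdiff] at hX'
  have hXX : K ∩ ((X ∪ X') \ B) = K ∩ (X \ B) := by
    grind
  rw [hXX] at hK ⊢
  have hB := h.bag_subset
  obtain ⟨C, Y, Z, p, q, a, rfl, hp, hpY, hqZ, hYZ, hC, hCY, hCZ, hBY, hKY, hcardC, hq, ha⟩ :=
    h.split hK
  refine ⟨C, Y ∪ X', Z, p + f', q, a, add_right_comm _ _ _, hp.add h'.isCut,
    hpY.add h'.isLocal, hqZ, by grind, by grind, by grind, hCZ, by grind, by grind, hcardC, hq, ha⟩

/-- Merging two parts with the same root bag. -/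
theorem add (h : PartialReduction s K B X f) {X' : Finset V} {f' : Set V → ℝ≥0}
    (h' : PartialReduction s K B X' f') (hX : X ∩ X' ⊆ B) :
    PartialReduction s K B (X ∪ X') (f + f') := by
  by_cases hK' : (K ∩ (X' \ B)).Nonempty
  swap
  · exact h.add_aux h' hX hK'
  by_cases hK : (K ∩ (X \ B)).Nonempty
  swap
  · rw [add_comm, Finset.union_comm]
    exact h'.add_aux h (by rwa [Finset.inter_comm]) hK
  refine ⟨h.isCut.add h'.isCut, h.isLocal.add h'.isLocal,
    h.bag_subset.trans Finset.subset_union_left, h.card_bag, fun _ => ?_⟩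
  obtain ⟨b, hb, hle⟩ := h.represents_of_nonempty hK
  obtain ⟨b', hb', hle'⟩ := h'.represents_of_nonempty hK'
  have hB := h.bag_subset
  have hB' := h'.bag_subset
  have hcard : (K ∩ ((X ∪ X') \ B)).card = (K ∩ (X \ B)).card + (K ∩ (X' \ B)).card := by
    rw [← Finset.card_union_of_disjoint (by rw [Finset.disjoint_left]; grind)]
    congr 1
    grind
  refine ⟨B, B, X ∪ X', 0, f + f', b + b', by simp, IsCutFunction.zero, IsLocal.zero _,
    h.isLocal.add h'.isLocal, by grind, by grind, subset_rfl, by grind, subset_rfl, by grind,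
    h.card_bag, (hb.add hb' h.isLocal h'.isLocal (by grind) (by grind) (by grind)).mono
      (by grind) le_rfl, ?_⟩
  rw [hcard]
  generalize 2 ^ 2 ^ (2 * s) = P at hle hle' ⊢
  linarith

end PartialReduction

/-- Eliminating the nodes of a rooted tree decomposition, those farthest from the root first. -/
theorem PartialReduction.eliminate {V ι : Type*} [Fintype V] [DecidableEq V] [DecidableEq ι]
    {s : ℕ} {K : Finset V} (B : ι → Finset V) (r : ι) (d : ι → ℕ) (p : ι → ι)
    (hr₀ : ∀ i, d r ≤ d i) (hp : ∀ i, i ≠ r → d (p i) < d i ∧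
      ∀ j, j ≠ i → d j ≤ d i → ∀ v, v ∈ B i → v ∈ B j → v ∈ B (p i)) (n : ℕ) :
    ∀ (I : Finset ι) (X : ι → Finset V) (f : ι → Set V → ℝ≥0), I.card = n → r ∈ I →
      (∀ i ∈ I, i ≠ r → p i ∈ I) → (∀ i ∈ I, PartialReduction s K (B i) (X i) (f i)) →
      (∀ i ∈ I, ∀ j ∈ I, i ≠ j → ∀ v, v ∈ X i → v ∈ X j → v ∈ B i ∧ v ∈ B j) →
      ∃ Y, PartialReduction s K (B r) Y (∑ i ∈ I, f i) ∧ ∀ i ∈ I, X i ⊆ Y := by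
  induction n with
  | zero =>
    intro I X f hI hr
    rw [Finset.card_eq_zero.1 hI] at hr
    simp at hr
  | succ n ih =>
    intro I X f hI hr hclosed hred hinter
    by_cases hne : (I.erase r).Nonempty
    swap
    · have hIr : I = {r} := by
        ext i
        rw [Finset.not_nonempty_iff_eq_empty] at hne
        have := Finset.ext_iff.1 hne i
        grind
      subst hIr
      exact ⟨X r, by simpa using hred r hr, by simp⟩
    -- A deepest node is the parent of no remaining node, so it can be merged into its own parent.
    obtain ⟨l, hl, hmax⟩ := Finset.exists_max_image (I.erase r) d hne
    have hlr : l ≠ r := Finset.ne_of_mem_erase hl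
    have hlI : l ∈ I := Finset.mem_of_mem_erase hl
    obtain ⟨hdl, hpl⟩ := hp l hlr
    have hplI := hclosed l hlI hlr
    have hpne : p l ≠ l := fun h => by rw [h] at hdl; omega
    have hle : ∀ i ∈ I, d i ≤ d l := by
      intro i hi
      by_cases hir : i = r
      · exact hir ▸ hr₀ l
      · exact hmax i (Finset.mem_erase.2 ⟨hir, hi⟩)
    have hBX : B (p l) ∩ X l ⊆ B l := by
      intro v hv
      rw [Finset.mem_inter] at hv
      exact (hinter l hlI _ hplI hpne.symm v hv.2 ((hred _ hplI).bag_subset hv.1)).1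
    have hmove := (hred l hlI).change_bag (hred _ hplI).card_bag hBX
    have hmerge := (hred _ hplI).add hmove (by
      intro v hv
      have := hinter l hlI _ hplI hpne.symm v
      grind)
    let X' := Function.update X (p l) (X (p l) ∪ (X l ∪ B (p l)))
    let f' := Function.update f (p l) (f (p l) + f l)
    have hX' : ∀ i, i ≠ p l → X' i = X i := fun i hi => Function.update_of_ne hi _ _
    have hX'p : X' (p l) = X (p l) ∪ (X l ∪ B (p l)) := Function.update_self _ _ _
    have hXp := (hred _ hplI).bag_subset
    -- A vertex shared by the parts of `l` and `j` lies in both bags, hence in the bag of `p l`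
    -- because `j` is no deeper than `l`.
    have hcross : ∀ j ∈ I, j ≠ l → j ≠ p l → ∀ v, v ∈ X' (p l) → v ∈ X j →
        v ∈ B (p l) ∧ v ∈ B j := by
      intro j hj hjl hjp v hv hvj
      rw [hX'p] at hv
      have h₁ := hinter j hj l hlI hjl v hvj
      have h₂ := hinter j hj _ hplI hjp v hvj
      have h₃ := hpl j hjl (hle j hj) v
      grind
    obtain ⟨Y, hY, hXY⟩ := ih (I.erase l) X' f' (by rw [Finset.card_erase_of_mem hlI]; omega)
      (Finset.mem_erase.2 ⟨hlr.symm, hr⟩) (by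
        intro i hi hir
        rw [Finset.mem_erase] at hi ⊢
        refine ⟨fun h => ?_, hclosed i hi.2 hir⟩
        have := (hp i hir).1
        have := hle i hi.2
        rw [h] at *
        omega) (by
        intro i hi
        by_cases hip : i = p l
        · subst hip
          simpa [X', f'] using hmerge
        · simpa [X', f', hip] using hred i (Finset.mem_of_mem_erase hi)) (by
        intro i hi j hj hij v hvi hvj
        rw [Finset.mem_erase] at hi hj
        by_cases hip : i = p l
        · subst hip
          rw [hX' j hij.symm] at hvj
          exact hcross j hj.2 hj.1 hij.symm v hvi hvj
        · by_cases hjp : j = p l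
          · subst hjp
            rw [hX' i hij] at hvi
            exact (hcross i hi.2 hi.1 hij v hvj hvi).symm
          · rw [hX' i hip] at hvi
            rw [hX' j hjp] at hvj
            exact hinter i hi.2 j hj.2 hij v hvi hvj)
    have hmem : p l ∈ I.erase l := Finset.mem_erase.2 ⟨hpne, hplI⟩
    have hXpY := hXY _ hmem
    rw [hX'p] at hXpY
    refine ⟨Y, ?_, fun i hi => ?_⟩
    · have hsum : ∑ i ∈ I.erase l, f' i = ∑ i ∈ I, f i := by
        rw [Finset.sum_update_of_mem hmem, ← Finset.add_sum_erase _ _ hlI,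
          ← Finset.add_sum_erase _ _ hmem, Finset.sdiff_singleton_eq_erase]
        abel
      rwa [hsum] at hY
    · by_cases hil : i = l
      · subst hil
        exact fun v hv => hXpY (by simp [hv])
      · by_cases hip : i = p l
        · subst hip
          exact fun v hv => hXpY (by simp [hv])
        · have := hXY i (Finset.mem_erase.2 ⟨hil, hi⟩)
          rwa [hX' i hip] at this

/-! ### Assigning edges to bags, and the final bound -/

namespace TreeDecomposition

variable {V ι : Type*} {G : SimpleGraph V}

theorem exists_bag_of_mem_edgeSet (D : TreeDecomposition G ι) {z : Sym2 V} (hz : z ∈ G.edgeSet) :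
    ∃ i, ∀ v ∈ z, v ∈ D.bag i := by
  induction z with
  | _ a b =>
    obtain ⟨i, ha, hb⟩ := D.exists_bag_of_adj a b hz
    refine ⟨i, fun v hv => ?_⟩
    rcases Sym2.mem_iff.1 hv with rfl | rfl
    · exact ha
    · exact hb

end TreeDecomposition

theorem crosses_congr {V : Type*} {z : Sym2 V} {A A' : Set V} (h : ∀ v ∈ z, v ∈ A ↔ v ∈ A') :
    Crosses z A ↔ Crosses z A' := by
  induction z with
  | _ a b => simp [crosses_mk, h a (by simp), h b (by simp)]

namespace CapacitatedNetwork

open Classical in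
/-- Distributing the edges over the bags of a tree decomposition. -/
theorem exists_sum_eq_cutValue {V ι : Type*} [Fintype V] [Fintype ι] (G : CapacitatedNetwork V)
    (D : TreeDecomposition G.graph ι) :
    ∃ f : ι → Set V → ℝ≥0, (∀ i, IsCutFunction (f i)) ∧ (∀ i, IsLocal (f i) (D.bag i)) ∧
      ∀ A : Finset V, G.cutValue A = (∑ i, f i) (A : Set V) := by
  have hι := D.isTree.connected.nonempty
  have hnode : ∀ z : Sym2 V, ∃ i, z ∈ G.graph.edgeSet → ∀ v ∈ z, v ∈ D.bag i := by
    intro z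
    by_cases hz : z ∈ G.graph.edgeSet
    · exact (D.exists_bag_of_mem_edgeSet hz).imp fun _ h _ => h
    · exact ⟨hι.some, fun h => (hz h).elim⟩
  choose node hnode using hnode
  let c : ι → Sym2 V → ℝ≥0 := fun i z =>
    if z ∈ G.graph.edgeSet ∧ node z = i then G.cap z else 0
  refine ⟨fun i A => ∑ z, if Crosses z A then c i z else 0, fun i => ⟨c i, fun A => rfl⟩,
    fun i A A' h => Finset.sum_congr rfl fun z _ => ?_, fun A => ?_⟩
  · by_cases hz : z ∈ G.graph.edgeSet ∧ node z = i
    · exact if_congr (crosses_congr fun v hv => h v (hz.2 ▸ hnode z hz.1 v hv)) rfl rfl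
    · simp [c, hz]
  · rw [cutValue_eq_sum, Finset.sum_apply, Finset.sum_comm]
    refine Finset.sum_congr rfl fun z _ => ?_
    by_cases hz : z ∈ G.graph.edgeSet <;> by_cases hA : Crosses z (A : Set V) <;>
      simp [c, hz, hA]

theorem represents_of_treeDecomposition {V ι : Type*} [Fintype V] [Fintype ι]
    (G : CapacitatedNetwork V) {K : Finset V} (hK : K.Nonempty) (D : TreeDecomposition G.graph ι)
    {s : ℕ} (hs : ∀ i, (D.bag i).card ≤ s) :
    ∃ F : Set V → ℝ≥0, (∀ A : Finset V, G.cutValue A = F A) ∧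
      Represents F K (3 * K.card * 2 ^ 2 ^ (2 * s)) := by
  classical
  obtain ⟨f, hcut, hlocal, hsum⟩ := G.exists_sum_eq_cutValue D
  obtain ⟨r⟩ := D.isTree.connected.nonempty
  obtain ⟨d, p, hr, hp⟩ := D.exists_parent r
  refine ⟨∑ i, f i, hsum, ?_⟩
  obtain ⟨X, hX, hbag⟩ := PartialReduction.eliminate (s := s) (K := K) D.bag r d p hr hp _
    Finset.univ D.bag f rfl (Finset.mem_univ _) (fun _ _ _ => Finset.mem_univ _)
    (fun i _ => PartialReduction.of_isLocal_bag (hcut i) (hlocal i) (hs i))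
    (fun i _ j _ _ v hi hj => ⟨hi, hj⟩)
  have hKX : K ⊆ X := fun v _ => by
    obtain ⟨i, hi⟩ := (D.connected_bags v).nonempty
    exact hbag i (Finset.mem_univ _) hi
  have hsub : K ⊆ D.bag r ∪ (K ∩ X) := fun v hv => by simp [hv, hKX hv]
  have hpos := hK.card_pos
  by_cases h : (K ∩ (X \ D.bag r)).Nonempty
  · obtain ⟨b, hb, hle⟩ := hX.represents_of_nonempty h
    refine hb.mono hsub (le_trans (Nat.le_add_right _ _) (hle.trans (Nat.mul_le_mul_right _ ?_)))
    exact Nat.mul_le_mul_left _ (Finset.card_le_card Finset.inter_subset_left)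
  · exact (hX.represents_of_not_nonempty h).mono hsub (Nat.le_mul_of_pos_left _ (by omega))

theorem cutValue_eq_zero_of_hasTreewidthAtMost_zero {V : Type*} [Fintype V]
    (G : CapacitatedNetwork V) (h : HasTreewidthAtMost G.graph 0) (A : Finset V) :
    G.cutValue A = 0 := by
  classical
  obtain ⟨m, D, hD⟩ := h
  rw [cutValue_eq_sum]
  refine Finset.sum_eq_zero fun z _ => if_neg ?_
  rintro ⟨hz, u, v, hu, hv, rfl⟩
  obtain ⟨i, hui, hvi⟩ := D.exists_bag_of_adj u v hz
  exact hv (Finset.card_le_one.1 (hD i) u hui v hvi ▸ hu)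

theorem terminalCut_eq_zero_of_isEmpty {V T : Type*} [Fintype V] [IsEmpty T]
    (G : CapacitatedNetwork V) (τ : T ↪ V) (U : Finset T) : G.terminalCut τ U = 0 := by
  refine le_antisymm ?_ zero_le
  have hmem : (∅ : Finset V) ∈ separatingSets τ U := by simp [separatingSets]
  refine (Finset.inf'_le _ hmem).trans (le_of_eq ?_)
  simp [cutValue, crossingEdges]

end CapacitatedNetwork

theorem mainTheorem5 {V : Type*} [Fintype V] (G : CapacitatedNetwork V) (K : Finset V)
    (n t k : ℕ) (hn : Fintype.card V = n) (ht : treewidth G.graph = t) (hk : K.card = k) :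
    ∃ (m : ℕ) (H : CapacitatedNetwork (Fin m)) (σ : K ↪ Fin m),
      G.IsMimickingNetwork K H σ ∧
        m ≤ k * 2 ^ Nat.choose (3 * (t + 1)) (3 * (t + 1) / 2) := by
  have htw := hasTreewidthAtMost_treewidth G.graph
  rw [ht] at htw
  rcases K.eq_empty_or_nonempty with rfl | hK
  -- Without terminals the bound is `0`, and the empty set is a cut of value zero in both networks.
  · exact ⟨0, ⟨⊥, 0⟩, Function.Embedding.ofIsEmpty, fun U => by
      rw [CapacitatedNetwork.terminalCut_eq_zero_of_isEmpty,
        CapacitatedNetwork.terminalCut_eq_zero_of_isEmpty], Nat.zero_le _⟩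
  obtain ⟨F, hF, b, hb, hle⟩ : ∃ F : Set V → ℝ≥0, (∀ A : Finset V, G.cutValue A = F A) ∧
      ∃ b, Represents F K b ∧ b ≤ k * 2 ^ Nat.choose (3 * (t + 1)) (3 * (t + 1) / 2) := by
    rcases Nat.eq_zero_or_pos t with rfl | ht₀
    · exact ⟨0, fun A => G.cutValue_eq_zero_of_hasTreewidthAtMost_zero htw A, _,
        Represents.zero hK, by rw [hk]; exact Nat.le_mul_of_pos_right _ (by positivity)⟩
    · obtain ⟨m, D, hD⟩ := htw
      obtain ⟨F, hF, hrep⟩ := G.represents_of_treeDecomposition hK D hD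
      refine ⟨F, hF, _, hrep, ?_⟩
      have hpow := Nat.pow_le_pow_right (n := 2) (by norm_num)
        (four_pow_add_four_le_choose (s := t + 1) (by omega))
      rw [pow_add] at hpow
      rw [hk, pow_mul, mul_comm 3 k, mul_assoc]
      exact Nat.mul_le_mul_left k (by norm_num at hpow ⊢; omega)
  obtain ⟨m, H, σ, hH, hm⟩ := G.exists_isMimickingNetwork K hF hb
  exact ⟨m, H, σ, hH, hm.trans hle⟩
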